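/- For $n\ge 1$ let $A_n$ and $S_n$ denote respectively the maximum and the sum of the absolute values of the coefficients of the $n$-th cyclotomic polynomial $\Phi_n$. For $k\ge 1$ let $\varepsilon_k$ be the smallest positive real number such that $$A_{p_1\cdots p_k}\le \varepsilon_k M_k,\qquad M_k=\prod_{i=1}^{k-2}p_i^{2^{k-i-1}-1},$$ for all distinct primes $p_1,\ldots,p_k$ (with $M_1=M_2=1$). Let $$d=\sup_{p,q,r}\frac{S_{pqr}}{p^2qr},\qquad \rho=\prod_{i=0}^{\infty}\left(\frac{2i+5}{2i+6}\right)^{1/2^i},\qquad C=\left(\tfrac34\,\varepsilon_3^{3/2}\,d\,\rho^{1/4}\right)^{1/32},$$ where the supremum is over all triples of distinct primes. Then every $\varepsilon_k$ exists, $d$ is finite, the product $\rho$ converges, and $$\log\varepsilon_k\le 2^k\log(C+o(1))\qquad (k\to\infty),$$ that is, there is a real sequence $(\delta_k)$ with $\delta_k\to0$ such that $C+\delta_k>0$ and $\log\varepsilon_k\le 2^k\log(C+\delta_k)$ for all $k\ge1$. -/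

import Mathlib

open Filter Topology

/-- `A_n`: the height of the `n`-th cyclotomic polynomial, the largest absolute value of
a coefficient. -/
noncomputable def cycHeight (n : ℕ) : ℕ :=
  (Finset.range (Nat.totient n + 1)).sup
    fun m => ((Polynomial.cyclotomic n ℤ).coeff m).natAbs

/-- `S_n`: the sum of the absolute values of the coefficients of the `n`-th cyclotomic
polynomial. -/
noncomputable def cycLength (n : ℕ) : ℕ :=
  ∑ m ∈ Finset.range (Nat.totient n + 1), ((Polynomial.cyclotomic n ℤ).coeff m).natAbs

/-- `p 1, …, p k` are distinct primes (the other values of `p` play no role). -/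
def DistinctPrimes (k : ℕ) (p : ℕ → ℕ) : Prop :=
  (∀ i ∈ Finset.Icc 1 k, (p i).Prime) ∧ Set.InjOn p (Set.Icc 1 k)

/-- `M_k = ∏_{i=1}^{k-2} p_i ^ (2^(k-i-1) - 1)`, which is `1` for `k ≤ 2`. -/
def bigM (k : ℕ) (p : ℕ → ℕ) : ℕ :=
  ∏ i ∈ Finset.Icc 1 (k - 2), p i ^ (2 ^ (k - i - 1) - 1)

/-- The positive constants `c` with `A_{p_1 ⋯ p_k} ≤ c M_k` for all distinct primes
`p_1, …, p_k`. -/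
def heightConstants (k : ℕ) : Set ℝ :=
  {c | 0 < c ∧ ∀ p : ℕ → ℕ, DistinctPrimes k p →
    (cycHeight (∏ i ∈ Finset.Icc 1 k, p i) : ℝ) ≤ c * (bigM k p : ℝ)}

/-- `ε_k`: the smallest element of `heightConstants k`. -/
noncomputable def eps (k : ℕ) : ℝ := sInf (heightConstants k)

/-- The values `S_{pqr} / (p² q r)` for distinct primes `p`, `q`, `r`. -/
def lengthRatios : Set ℝ :=
  {x | ∃ p q r : ℕ, p.Prime ∧ q.Prime ∧ r.Prime ∧ p ≠ q ∧ p ≠ r ∧ q ≠ r ∧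
    x = (cycLength (p * q * r) : ℝ) / ((p : ℝ) ^ 2 * q * r)}

/-- `d`: the supremum of `S_{pqr} / (p² q r)`. -/
noncomputable def dConst : ℝ := sSup lengthRatios

/-- The `i`-th factor of the infinite product `ρ`. -/
noncomputable def rhoFactor (i : ℕ) : ℝ :=
  ((2 * (i : ℝ) + 5) / (2 * (i : ℝ) + 6)) ^ (1 / (2 : ℝ) ^ i)

/-- `ρ = ∏_{i ≥ 0} ((2i+5)/(2i+6))^(1/2^i)`. -/
noncomputable def rhoConst : ℝ := ∏' i : ℕ, rhoFactor i

/-- `C = ((3/4) ε_3^(3/2) d ρ^(1/4))^(1/32)`. -/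
noncomputable def bigC : ℝ :=
  (3 / 4 * eps 3 ^ (3 / 2 : ℝ) * dConst * rhoConst ^ (1 / 4 : ℝ)) ^ (1 / 32 : ℝ)

/-! ### Lengths of integer polynomials and the palindromic symmetry of `cyclotomic`. -/

section CoefficientSums

open Polynomial Finset

/-! Write Ψ_P = (X^P - 1)/Φ_P and let |f| be the sum of the absolute values of the coefficients of
f. For a prime p not dividing P > 1, Φ_{Pp} = -Ψ_P · Φ_P(X^p)/(1 - X^P) and Ψ_{Pp} = Ψ_P(X^p) Φ_P.
Each coefficient of the series Φ_P(X^p)/(1 - X^P) is 0 or a coefficient of Φ_P, and its coefficients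
up to degree φ(Pp) have absolute sum at most p|Φ_P|/2. Hence A_{Pp} ≤ A_P |Ψ_P|, |Φ_{Pp}| ≤
p|Φ_P||Ψ_P|/2 and |Ψ_{Pp}| ≤ |Φ_P||Ψ_P| (`cycHeight_mul_prime_le`,
`two_mul_coeffSum_cyclotomic_mul_prime_le`, `coeffSum_invCyclotomic_mul_prime_le`).

After division by the monomials in the p_i, these become recursions for constants alone: s ↦ st/2
for |Φ|, t ↦ st for |Ψ|, c ↦ ct for the height. After one step t = 2s, so from then on each step
squares s. Starting from |Φ_{pq}| ≤ (3/5)pq and |Φ_{pqr}| ≤ d p²qr gives s = (3d/5)^(2^k) at k + 4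
primes, and ε_{k+4} ≤ E 2^k (3d/5)^(2^k) for a constant E. The limsup of ε_k^(1/2^k) is therefore at
most (3d/5)^(1/16).

It remains to see that (3d/5)^(1/16) ≤ C, that is (3d/5)² ≤ (3/4) ε_3^(3/2) d ρ^(1/4). This follows
from the crude estimates d ≤ 3/5, ε_3 ≥ 1/2 and ρ ≥ 25/36 (`rpow_le_bigC`). -/

/-- The sum of the absolute values of the coefficients of an integer polynomial. -/
noncomputable def coeffSum (f : ℤ[X]) : ℕ := ∑ i ∈ f.support, (f.coeff i).natAbs

lemma coeffSum_eq_sum_range {f : ℤ[X]} {N : ℕ} (h : f.natDegree < N) :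
    coeffSum f = ∑ i ∈ range N, (f.coeff i).natAbs := by
  refine Finset.sum_subset (fun i hi => ?_) (fun i _ hi => ?_)
  · exact mem_range.2 ((le_natDegree_of_mem_supp i hi).trans_lt h)
  · simpa using hi

/-- The pairs with u + v < N form a triangle inside the square [0, N)². -/
lemma sum_range_antidiagonal_le (f g : ℕ → ℕ) (N : ℕ) :
    ∑ m ∈ range N, ∑ x ∈ antidiagonal m, f x.1 * g x.2 ≤
      (∑ u ∈ range N, f u) * ∑ v ∈ range N, g v := by
  rw [Finset.sum_mul_sum, ← Finset.sum_product' (range N) (range N) (fun u v => f u * g v),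
    Finset.sum_sigma']
  refine (Finset.sum_bij_ne_zero (t := (range N ×ˢ range N).filter fun x => x.1 + x.2 < N)
    (g := fun x => f x.1 * g x.2) (fun x _ _ => x.2) ?_ ?_ ?_ ?_).trans_le
      (Finset.sum_le_sum_of_subset (Finset.filter_subset _ _))
  · rintro ⟨m, u, v⟩ h _
    simp only [mem_sigma, mem_range, HasAntidiagonal.mem_antidiagonal] at h
    simp only [mem_filter, mem_product, mem_range]
    omega
  · rintro ⟨m, u, v⟩ h _ ⟨m', u', v'⟩ h' _ e
    simp only [mem_sigma, mem_range, HasAntidiagonal.mem_antidiagonal] at h h'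
    simp only [Prod.mk.injEq] at e
    obtain ⟨rfl, rfl⟩ := e
    obtain rfl : m = m' := by omega
    rfl
  · rintro ⟨u, v⟩ h hne
    simp only [mem_filter, mem_product, mem_range] at h
    exact ⟨⟨u + v, u, v⟩, by simp [h.2], hne, rfl⟩
  · intros; rfl

lemma natAbs_sum_antidiagonal_le (f g : ℕ → ℤ) (m : ℕ) :
    (∑ x ∈ antidiagonal m, f x.1 * g x.2).natAbs ≤
      ∑ x ∈ antidiagonal m, (f x.1).natAbs * (g x.2).natAbs :=
  (Int.natAbs_sum_le _ _).trans_eq (Finset.sum_congr rfl fun _ _ => Int.natAbs_mul _ _)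

lemma coeffSum_mul_le (f g : ℤ[X]) : coeffSum (f * g) ≤ coeffSum f * coeffSum g := by
  set N := f.natDegree + g.natDegree + 1
  rw [coeffSum_eq_sum_range (show (f * g).natDegree < N from Nat.lt_succ_of_le natDegree_mul_le),
    coeffSum_eq_sum_range (show f.natDegree < N by omega),
    coeffSum_eq_sum_range (show g.natDegree < N by omega)]
  refine le_trans (Finset.sum_le_sum fun m _ => ?_)
    (sum_range_antidiagonal_le (fun u => (f.coeff u).natAbs) (fun v => (g.coeff v).natAbs) N)
  rw [coeff_mul]
  exact natAbs_sum_antidiagonal_le _ _ m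

lemma coeffSum_add_le (f g : ℤ[X]) : coeffSum (f + g) ≤ coeffSum f + coeffSum g := by
  set N := max f.natDegree g.natDegree + 1
  have h1 : f.natDegree < N := Nat.lt_succ_of_le (le_max_left _ _)
  have h2 : g.natDegree < N := Nat.lt_succ_of_le (le_max_right _ _)
  rw [coeffSum_eq_sum_range (show (f + g).natDegree < N from
      Nat.lt_succ_of_le (natDegree_add_le _ _)),
    coeffSum_eq_sum_range h1, coeffSum_eq_sum_range h2, ← Finset.sum_add_distrib]
  refine Finset.sum_le_sum fun m _ => ?_
  rw [coeff_add]
  exact Int.natAbs_add_le _ _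

lemma coeffSum_neg (f : ℤ[X]) : coeffSum (-f) = coeffSum f := by
  simp [coeffSum]

lemma coeffSum_sub_le (f g : ℤ[X]) : coeffSum (f - g) ≤ coeffSum f + coeffSum g := by
  rw [sub_eq_add_neg, ← coeffSum_neg g]
  exact coeffSum_add_le _ _

lemma coeffSum_X_pow (n : ℕ) : coeffSum (X ^ n) = 1 := by
  simp [coeffSum]

lemma coeffSum_sum_X_pow_le (e : ℕ → ℕ) (a : ℕ) :
    coeffSum (∑ i ∈ range a, X ^ e i) ≤ a := by
  induction a with
  | zero => simp [coeffSum]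
  | succ a ih =>
    rw [Finset.sum_range_succ]
    exact (coeffSum_add_le _ _).trans (Nat.add_le_add ih (coeffSum_X_pow _).le)

lemma coeffSum_expand {p : ℕ} (hp : 0 < p) (f : ℤ[X]) :
    coeffSum (expand ℤ p f) = coeffSum f := by
  refine (Finset.sum_bij_ne_zero (fun i _ _ => i * p) ?_ ?_ ?_ ?_).symm
  · intro i _ h
    simpa [coeff_expand_mul hp] using h
  · intro i _ _ j _ _ h
    exact Nat.eq_of_mul_eq_mul_right hp h
  · intro i hi h
    rw [mem_support_iff, coeff_expand hp] at hi
    rw [coeff_expand hp] at h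
    by_cases hd : p ∣ i
    · rw [if_pos hd] at hi h
      exact ⟨i / p, mem_support_iff.2 hi, h, Nat.div_mul_cancel hd⟩
    · exact absurd (if_neg hd) hi
  · intro i _ _
    rw [coeff_expand_mul hp]

lemma coeffSum_pos {f : ℤ[X]} (hf : f.Monic) : 0 < coeffSum f := by
  refine Finset.sum_pos (fun i hi => ?_) ⟨f.natDegree, ?_⟩
  · exact Int.natAbs_pos.2 (mem_support_iff.1 hi)
  · rw [mem_support_iff, hf.coeff_natDegree]; exact one_ne_zero

lemma cycLength_eq_coeffSum (n : ℕ) : cycLength n = coeffSum (cyclotomic n ℤ) :=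
  (coeffSum_eq_sum_range (by rw [natDegree_cyclotomic]; omega)).symm

lemma natAbs_coeff_le_cycHeight (n m : ℕ) :
    ((cyclotomic n ℤ).coeff m).natAbs ≤ cycHeight n := by
  by_cases h : m < n.totient + 1
  · exact Finset.le_sup (f := fun m => ((cyclotomic n ℤ).coeff m).natAbs) (mem_range.2 h)
  · rw [coeff_eq_zero_of_natDegree_lt (by rw [natDegree_cyclotomic]; omega)]
    simp

lemma one_le_cycHeight (n : ℕ) : 1 ≤ cycHeight n := by
  refine le_trans ?_ (natAbs_coeff_le_cycHeight n (cyclotomic n ℤ).natDegree)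
  rw [(cyclotomic.monic n ℤ).coeff_natDegree]; simp

/-- Since ζ⁻¹ is also a primitive n-th root of unity, the reversed polynomial vanishes at ζ, so the
minimal polynomial Φ_n divides it. Both are monic and the reverse has no larger degree. -/
lemma reverse_cyclotomic {n : ℕ} (hn : 1 < n) : (cyclotomic n ℤ).reverse = cyclotomic n ℤ := by
  have hζ := Complex.isPrimitiveRoot_exp n (by omega)
  set ζ := Complex.exp (2 * Real.pi * Complex.I / n)
  have h0 : (cyclotomic n ℤ).coeff 0 = 1 := cyclotomic_coeff_zero ℤ hn
  have htr : (cyclotomic n ℤ).natTrailingDegree = 0 :=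
    natTrailingDegree_eq_zero.2 (Or.inr (by rw [h0]; exact one_ne_zero))
  have hmonic : (cyclotomic n ℤ).reverse.Monic := by
    rw [Monic, reverse_leadingCoeff, trailingCoeff, htr, h0]
  have hroot : eval₂ (algebraMap ℤ ℂ) ζ (cyclotomic n ℤ).reverse = 0 := by
    let : Invertible ζ⁻¹ := invertibleOfNonzero (inv_ne_zero (hζ.ne_zero (by omega)))
    have h := (eval₂_reverse_eq_zero_iff (algebraMap ℤ ℂ) ζ⁻¹ (cyclotomic n ℤ)).2 (by
      rw [eval₂_eq_eval_map, map_cyclotomic]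
      have : NeZero (n : ℂ) := ⟨by exact_mod_cast (by omega : n ≠ 0)⟩
      exact isRoot_cyclotomic_iff.2 hζ.inv)
    rwa [invOf_eq_inv, inv_inv] at h
  have hdvd : cyclotomic n ℤ ∣ (cyclotomic n ℤ).reverse := by
    rw [cyclotomic_eq_minpoly hζ (by omega)]
    refine minpoly.isIntegrallyClosed_dvd (hζ.isIntegral (by omega)) ?_
    rw [← cyclotomic_eq_minpoly hζ (by omega)]
    exact hroot
  exact (eq_of_monic_of_dvd_of_natDegree_le (cyclotomic.monic n ℤ) hmonic hdvd
    (reverse_natDegree_le _))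

lemma cyclotomic_coeff_sub {n i : ℕ} (hn : 1 < n) (hi : i ≤ n.totient) :
    (cyclotomic n ℤ).coeff (n.totient - i) = (cyclotomic n ℤ).coeff i := by
  conv_rhs => rw [← reverse_cyclotomic hn]
  rw [coeff_reverse, natDegree_cyclotomic, revAt_le hi]

end CoefficientSums

/-! ### Passing from P to Pp: heights and lengths of Φ and of the inverse polynomial. -/

section CyclotomicRecursion

open Polynomial Finset

/-- The inverse cyclotomic polynomial `(X ^ n - 1) / Φ_n`. -/
noncomputable def invCyclotomic (n : ℕ) : ℤ[X] := ∏ i ∈ n.properDivisors, cyclotomic i ℤ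

lemma cyclotomic_mul_invCyclotomic {n : ℕ} (hn : 0 < n) :
    cyclotomic n ℤ * invCyclotomic n = X ^ n - 1 := by
  rw [invCyclotomic, ← prod_cyclotomic_eq_X_pow_sub_one hn, ← Nat.insert_self_properDivisors hn.ne',
    Finset.prod_insert Nat.self_notMem_properDivisors]

lemma cyclotomic_mul_prime_mul_X_pow_sub_one {P p : ℕ} (hP : 0 < P) (hp : p.Prime) (hd : ¬p ∣ P) :
    cyclotomic (P * p) ℤ * (X ^ P - 1) = invCyclotomic P * expand ℤ p (cyclotomic P ℤ) := by
  rw [cyclotomic_expand_eq_cyclotomic_mul hp hd, ← cyclotomic_mul_invCyclotomic hP]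
  ring

lemma invCyclotomic_mul_prime {P p : ℕ} (hP : 0 < P) (hp : p.Prime) (hd : ¬p ∣ P) :
    invCyclotomic (P * p) = expand ℤ p (invCyclotomic P) * cyclotomic P ℤ := by
  apply mul_left_cancel₀ (cyclotomic_ne_zero (P * p) ℤ)
  have h := congrArg (expand ℤ p) (cyclotomic_mul_invCyclotomic hP)
  rw [map_mul, cyclotomic_expand_eq_cyclotomic_mul hp hd, map_sub, map_pow, expand_X, map_one,
    ← pow_mul, mul_comm p P] at h
  rw [cyclotomic_mul_invCyclotomic (Nat.mul_pos hP hp.pos), ← h]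
  ring

lemma coeffSum_invCyclotomic_mul_prime_le {P p : ℕ} (hP : 0 < P) (hp : p.Prime) (hd : ¬p ∣ P) :
    coeffSum (invCyclotomic (P * p)) ≤
      coeffSum (cyclotomic P ℤ) * coeffSum (invCyclotomic P) := by
  rw [invCyclotomic_mul_prime hP hp hd, mul_comm (coeffSum _)]
  exact (coeffSum_mul_le _ _).trans_eq (by rw [coeffSum_expand hp.pos])

/-- The `v`-th coefficient of the power series `Φ_P(X ^ p) / (1 - X ^ P)`. -/
noncomputable def seriesCoeff (P p v : ℕ) : ℤ :=
  ∑ i ∈ range (P.totient + 1),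
    if i * p ≤ v ∧ P ∣ v - i * p then (cyclotomic P ℤ).coeff i else 0

lemma mk_dvd_mul_one_sub_X_pow {P : ℕ} (hP : 0 < P) :
    (PowerSeries.mk fun n => if P ∣ n then (1 : ℤ) else 0) * (1 - PowerSeries.X ^ P) = 1 := by
  ext n
  rw [mul_sub, mul_one, map_sub, PowerSeries.coeff_mul_X_pow', PowerSeries.coeff_mk,
    PowerSeries.coeff_mk, PowerSeries.coeff_one]
  rcases Nat.eq_zero_or_pos n with rfl | hn
  · simp [hP.ne']
  · rw [if_neg hn.ne']
    by_cases h : P ≤ n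
    · rw [if_pos h, if_congr (Nat.dvd_sub_iff_left h dvd_rfl) rfl rfl, sub_self]
    · rw [if_neg h, if_neg (fun hd => h (Nat.le_of_dvd hn hd)), sub_self]

lemma coeff_expand_mul_mk_dvd {P p : ℕ} (v : ℕ) :
    PowerSeries.coeff v ((expand ℤ p (cyclotomic P ℤ) : PowerSeries ℤ) *
      PowerSeries.mk fun n => if P ∣ n then (1 : ℤ) else 0) = seriesCoeff P p v := by
  have h : expand ℤ p (cyclotomic P ℤ) =
      ∑ i ∈ range (P.totient + 1), C ((cyclotomic P ℤ).coeff i) * X ^ (i * p) := by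
    conv_lhs => rw [(cyclotomic P ℤ).as_sum_range' (P.totient + 1)
      (by rw [natDegree_cyclotomic]; omega)]
    rw [map_sum]
    refine Finset.sum_congr rfl fun i _ => ?_
    rw [expand_monomial, C_mul_X_pow_eq_monomial]
  rw [h, ← coeToPowerSeries.ringHom_apply, map_sum, Finset.sum_mul, map_sum, seriesCoeff]
  refine Finset.sum_congr rfl fun i _ => ?_
  rw [coeToPowerSeries.ringHom_apply, Polynomial.coe_mul, Polynomial.coe_pow, coe_C, coe_X, mul_assoc,
    PowerSeries.coeff_C_mul, mul_comm (PowerSeries.X ^ _), PowerSeries.coeff_mul_X_pow',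
    PowerSeries.coeff_mk]
  by_cases h1 : i * p ≤ v <;> by_cases h2 : P ∣ v - i * p <;> simp [h1, h2]

lemma cyclotomic_mul_prime_coeff {P p : ℕ} (hP : 0 < P) (hp : p.Prime) (hd : ¬p ∣ P) (m : ℕ) :
    (cyclotomic (P * p) ℤ).coeff m =
      -∑ x ∈ antidiagonal m, (invCyclotomic P).coeff x.1 * seriesCoeff P p x.2 := by
  have h := congrArg (coeToPowerSeries.ringHom (R := ℤ))
    (cyclotomic_mul_prime_mul_X_pow_sub_one hP hp hd)
  simp only [map_mul, map_sub, map_pow, map_one, coeToPowerSeries.ringHom_apply, coe_X] at h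
  set E := PowerSeries.mk fun n => if P ∣ n then (1 : ℤ) else 0
  have hE : E * (1 - PowerSeries.X ^ P) = 1 := mk_dvd_mul_one_sub_X_pow hP
  have h2 : (cyclotomic (P * p) ℤ : PowerSeries ℤ) =
      -((invCyclotomic P : PowerSeries ℤ) *
        ((expand ℤ p (cyclotomic P ℤ) : PowerSeries ℤ) * E)) := by
    -- `E` is the inverse of 1 - X^P, so multiplying `h` by -`E` isolates Φ_{Pp}.
    linear_combination (-E) * h - (cyclotomic (P * p) ℤ : PowerSeries ℤ) * hE
  rw [← coeff_coe, h2, map_neg, PowerSeries.coeff_mul]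
  simp only [coeff_coe, coeff_expand_mul_mk_dvd, E]

/-- The sum has at most one nonzero term: v ≡ ip (mod P) determines i modulo P, and i ≤ φ(P) < P. -/
lemma natAbs_seriesCoeff_le_cycHeight {P p : ℕ} (hP : 1 < P) (hp : p.Prime) (hd : ¬p ∣ P) (v : ℕ) :
    (seriesCoeff P p v).natAbs ≤ cycHeight P := by
  have hcop : P.Coprime p := ((Nat.Prime.coprime_iff_not_dvd hp).2 hd).symm
  have huniq : ∀ i ∈ range (P.totient + 1), ∀ j ∈ range (P.totient + 1),
      (i * p ≤ v ∧ P ∣ v - i * p) → (j * p ≤ v ∧ P ∣ v - j * p) → i = j := by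
    intro i hi j hj h1 h2
    have hφ := Nat.totient_lt P hP
    rw [mem_range] at hi hj
    have e1 : i * p ≡ v [MOD P] := (Nat.modEq_iff_dvd' h1.1).2 h1.2
    have e2 : j * p ≡ v [MOD P] := (Nat.modEq_iff_dvd' h2.1).2 h2.2
    exact ((e1.trans e2.symm).cancel_right_of_coprime hcop).eq_of_lt_of_lt (by omega) (by omega)
  by_cases hex : ∃ i ∈ range (P.totient + 1), i * p ≤ v ∧ P ∣ v - i * p
  · obtain ⟨i, hi, hiv⟩ := hex
    rw [seriesCoeff, Finset.sum_eq_single_of_mem i hi, if_pos hiv]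
    · exact natAbs_coeff_le_cycHeight P i
    · intro j hj hji
      exact if_neg fun h => hji (huniq j hj i hi h hiv)
  · push Not at hex
    rw [seriesCoeff, Finset.sum_eq_zero fun i hi => if_neg fun h => hex i hi h.1 h.2]
    simp

lemma cycHeight_mul_prime_le {P p : ℕ} (hP : 1 < P) (hp : p.Prime) (hd : ¬p ∣ P) :
    cycHeight (P * p) ≤ cycHeight P * coeffSum (invCyclotomic P) := by
  refine Finset.sup_le fun m _ => ?_
  rw [cyclotomic_mul_prime_coeff (by omega) hp hd, Int.natAbs_neg]
  refine (natAbs_sum_antidiagonal_le _ _ m).trans ?_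
  rw [Finset.Nat.sum_antidiagonal_eq_sum_range_succ_mk]
  calc ∑ k ∈ range m.succ, ((invCyclotomic P).coeff k).natAbs * (seriesCoeff P p (m - k)).natAbs
      ≤ ∑ k ∈ range m.succ, ((invCyclotomic P).coeff k).natAbs * cycHeight P :=
        Finset.sum_le_sum fun k _ =>
          Nat.mul_le_mul_left _ (natAbs_seriesCoeff_le_cycHeight hP hp hd _)
    _ ≤ ∑ k ∈ range (max m (invCyclotomic P).natDegree + 1),
          ((invCyclotomic P).coeff k).natAbs * cycHeight P :=
        Finset.sum_le_sum_of_subset (range_subset_range.2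
          (Nat.succ_le_succ (le_max_left _ _)))
    _ = cycHeight P * coeffSum (invCyclotomic P) := by
        rw [← Finset.sum_mul, mul_comm,
          coeffSum_eq_sum_range (Nat.lt_succ_of_le (le_max_right _ _))]

lemma card_filter_dvd_sub_mul_le {P D a : ℕ} (hP : 0 < P) (h : a ≤ D + P) :
    (#{v ∈ range (D + 1) | a ≤ v ∧ P ∣ v - a}) * P ≤ D + P - a := by
  have hsub : {v ∈ range (D + 1) | a ≤ v ∧ P ∣ v - a} ⊆
      (range ((D + P - a) / P)).image fun t => a + P * t := by
    intro v hv
    simp only [mem_filter, mem_range] at hv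
    obtain ⟨hvD, hav, t, ht⟩ := hv
    refine mem_image.2 ⟨t, mem_range.2 ?_, by omega⟩
    rw [← Nat.succ_le_iff, Nat.le_div_iff_mul_le hP, Nat.succ_mul, mul_comm]
    omega
  refine le_trans (Nat.mul_le_mul_right P ((card_le_card hsub).trans card_image_le)) ?_
  rw [card_range]
  exact Nat.div_mul_le_self _ _

/-- By the symmetry i ↔ φ(P) - i, the weighted mean of i is φ(P)/2. -/
lemma two_mul_sum_natAbs_coeff_mul {P : ℕ} (hP : 1 < P) :
    2 * ∑ i ∈ range (P.totient + 1), ((cyclotomic P ℤ).coeff i).natAbs * i =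
      P.totient * coeffSum (cyclotomic P ℤ) := by
  rw [coeffSum_eq_sum_range (show (cyclotomic P ℤ).natDegree < P.totient + 1 by
    rw [natDegree_cyclotomic]; omega), two_mul]
  nth_rewrite 1 [← Finset.sum_range_reflect]
  rw [← Finset.sum_add_distrib, Finset.mul_sum]
  refine Finset.sum_congr rfl fun i hi => ?_
  have hi' : i ≤ P.totient := Nat.lt_succ_iff.1 (mem_range.1 hi)
  rw [Nat.add_sub_cancel, cyclotomic_coeff_sub hP hi', ← mul_add, Nat.sub_add_cancel hi', mul_comm]

/-- The i-th coefficient of Φ_P contributes to at most (D + P - ip)/P indices v ≤ D. Averaging over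
i by the palindromic symmetry replaces i by φ(P)/2, and this is what gains the factor 1/2. -/
lemma two_mul_sum_natAbs_seriesCoeff_le {P p : ℕ} (hP : 1 < P) (hp : p.Prime) :
    2 * ∑ v ∈ range (P.totient * (p - 1) + 1), (seriesCoeff P p v).natAbs ≤
      p * coeffSum (cyclotomic P ℤ) := by
  set D := P.totient * (p - 1) with hD
  set a : ℕ → ℕ := fun i => ((cyclotomic P ℤ).coeff i).natAbs with ha
  have hφ : P.totient < P := Nat.totient_lt P hP
  have hDp : D + P.totient = P.totient * p := by
    rw [hD, ← Nat.mul_succ, Nat.succ_eq_add_one, Nat.sub_add_cancel hp.one_le]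
  have hip : ∀ i ∈ range (P.totient + 1), i * p ≤ D + P := fun i hi => by
    have := Nat.mul_le_mul_right p (Nat.lt_succ_iff.1 (mem_range.1 hi))
    omega
  have hS : coeffSum (cyclotomic P ℤ) = ∑ i ∈ range (P.totient + 1), a i :=
    coeffSum_eq_sum_range (by rw [natDegree_cyclotomic]; omega)
  have h1 : ∑ v ∈ range (D + 1), (seriesCoeff P p v).natAbs ≤
      ∑ i ∈ range (P.totient + 1), a i * #{v ∈ range (D + 1) | i * p ≤ v ∧ P ∣ v - i * p} := by
    calc ∑ v ∈ range (D + 1), (seriesCoeff P p v).natAbs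
        ≤ ∑ v ∈ range (D + 1), ∑ i ∈ range (P.totient + 1),
            if i * p ≤ v ∧ P ∣ v - i * p then a i else 0 := by
          refine Finset.sum_le_sum fun v _ => (Int.natAbs_sum_le _ _).trans_eq ?_
          refine Finset.sum_congr rfl fun i _ => ?_
          split_ifs <;> simp [ha]
      _ = _ := by
          rw [Finset.sum_comm]
          refine Finset.sum_congr rfl fun i _ => ?_
          rw [← Finset.sum_filter, Finset.sum_const, smul_eq_mul, mul_comm]
  have h2 : (∑ v ∈ range (D + 1), (seriesCoeff P p v).natAbs) * P +
      p * ∑ i ∈ range (P.totient + 1), a i * i ≤ (D + P) * coeffSum (cyclotomic P ℤ) := by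
    refine (Nat.add_le_add_right (Nat.mul_le_mul_right P h1) _).trans ?_
    rw [hS, Finset.sum_mul, Finset.mul_sum, Finset.mul_sum, ← Finset.sum_add_distrib]
    refine Finset.sum_le_sum fun i hi => ?_
    have h3 := card_filter_dvd_sub_mul_le (by omega : 0 < P) (hip i hi)
    have h4 : #{v ∈ range (D + 1) | i * p ≤ v ∧ P ∣ v - i * p} * P + i * p ≤ D + P := by
      have := hip i hi
      omega
    calc _ = a i * (#{v ∈ range (D + 1) | i * p ≤ v ∧ P ∣ v - i * p} * P + i * p) := by ring
      _ ≤ a i * (D + P) := Nat.mul_le_mul_left _ h4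
      _ = _ := mul_comm _ _
  have h5 := two_mul_sum_natAbs_coeff_mul hP
  -- With D = φ(P)(p - 1), this is equivalent to φ(P)(p - 2) ≤ P(p - 2).
  have h6 : 2 * D + 2 * P ≤ P.totient * p + P * p := by
    obtain ⟨q, rfl⟩ : ∃ q, p = q + 2 := ⟨p - 2, by have := hp.two_le; omega⟩
    have : P.totient * q ≤ P * q := Nat.mul_le_mul_right q hφ.le
    have e : q + 2 - 1 = q + 1 := by omega
    rw [hD, e]
    nlinarith
  refine Nat.le_of_mul_le_mul_right (c := P) ?_ (by omega)
  have h7 := Nat.mul_le_mul_right (coeffSum (cyclotomic P ℤ)) h6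
  have h8 : p * (2 * ∑ i ∈ range (P.totient + 1), a i * i) =
    p * (P.totient * coeffSum (cyclotomic P ℤ)) := congrArg (p * ·) h5
  nlinarith

lemma two_mul_coeffSum_cyclotomic_mul_prime_le {P p : ℕ} (hP : 1 < P) (hp : p.Prime)
    (hd : ¬p ∣ P) :
    2 * coeffSum (cyclotomic (P * p) ℤ) ≤
      p * (coeffSum (cyclotomic P ℤ) * coeffSum (invCyclotomic P)) := by
  have hdeg : (P * p).totient = P.totient * (p - 1) := by
    rw [Nat.totient_mul ((Nat.Prime.coprime_iff_not_dvd hp).2 hd).symm, Nat.totient_prime hp]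
  set N := P.totient * (p - 1) + 1
  have hG : ∑ u ∈ range N, ((invCyclotomic P).coeff u).natAbs ≤ coeffSum (invCyclotomic P) := by
    rw [coeffSum_eq_sum_range (N := max N (invCyclotomic P).natDegree + 1)
      (Nat.lt_succ_of_le (le_max_right _ _))]
    exact Finset.sum_le_sum_of_subset
      (range_subset_range.2 ((le_max_left _ _).trans (Nat.le_succ _)))
  have h : coeffSum (cyclotomic (P * p) ℤ) ≤
      coeffSum (invCyclotomic P) * ∑ v ∈ range N, (seriesCoeff P p v).natAbs := by
    rw [coeffSum_eq_sum_range (show (cyclotomic (P * p) ℤ).natDegree < N by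
      rw [natDegree_cyclotomic, hdeg]; omega)]
    refine le_trans (Finset.sum_le_sum fun m _ => ?_)
      ((sum_range_antidiagonal_le (fun u => ((invCyclotomic P).coeff u).natAbs)
        (fun v => (seriesCoeff P p v).natAbs) N).trans (Nat.mul_le_mul_right _ hG))
    rw [cyclotomic_mul_prime_coeff (by omega) hp hd, Int.natAbs_neg]
    exact natAbs_sum_antidiagonal_le _ _ m
  calc _ ≤ coeffSum (invCyclotomic P) * (2 * ∑ v ∈ range N, (seriesCoeff P p v).natAbs) := by
        linarith
    _ ≤ coeffSum (invCyclotomic P) * (p * coeffSum (cyclotomic P ℤ)) :=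
        Nat.mul_le_mul_left _ (two_mul_sum_natAbs_seriesCoeff_le hP hp)
    _ = _ := by ring

/-! ### Explicit estimates for one and two primes. -/

lemma coeffSum_cyclotomic_prime_le {p : ℕ} (hp : p.Prime) : coeffSum (cyclotomic p ℤ) ≤ p := by
  have : Fact p.Prime := ⟨hp⟩
  rw [cyclotomic_prime]
  exact coeffSum_sum_X_pow_le id p

lemma coeffSum_invCyclotomic_prime_le {p : ℕ} (hp : p.Prime) :
    coeffSum (invCyclotomic p) ≤ 2 := by
  rw [invCyclotomic, hp.properDivisors, Finset.prod_singleton, cyclotomic_one]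
  refine (coeffSum_sub_le _ _).trans ?_
  rw [← pow_one (X : ℤ[X]), ← pow_zero (X : ℤ[X]), coeffSum_X_pow, coeffSum_X_pow]

lemma cycHeight_prime_le {p : ℕ} (hp : p.Prime) : cycHeight p ≤ 1 := by
  have : Fact p.Prime := ⟨hp⟩
  refine Finset.sup_le fun m _ => ?_
  rw [cyclotomic_prime, finsetSum_coeff]
  simp only [coeff_X_pow, Finset.sum_ite_eq]
  split_ifs <;> simp

lemma exists_mul_add_mul_eq {p q : ℕ} (hp : 1 < p) (hq : 1 < q) (h : p.Coprime q) :
    ∃ a b : ℕ, a ≤ q ∧ b ≤ p ∧ p * a + q * b = p * q + 1 := by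
  obtain ⟨a, ha, hpa⟩ := Nat.exists_mul_mod_eq_one_of_coprime h hq
  have h1 := Nat.div_add_mod (p * a) q
  have h2 : p * a / q < p := by
    rw [Nat.div_lt_iff_lt_mul (by omega)]
    exact Nat.mul_lt_mul_of_pos_left ha (by omega)
  -- Here a is the inverse of p modulo q, so pa = q⌊pa/q⌋ + 1.
  refine ⟨a, p - p * a / q, ha.le, Nat.sub_le _ _, ?_⟩
  have h3 : q * (p * a / q) + q * (p - p * a / q) = q * p := by
    rw [← mul_add, Nat.add_sub_cancel' h2.le]
  rw [mul_comm p q]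
  omega

lemma cyclotomic_mul_eq_geom_sums {p q a b : ℕ} (hp : p.Prime) (hq : q.Prime) (hpq : p ≠ q)
    (ha : a ≤ q) (hb : b ≤ p) (hab : p * a + q * b = p * q + 1) :
    cyclotomic (p * q) ℤ =
      (∑ i ∈ range a, X ^ (p * i)) * (∑ j ∈ range b, X ^ (q * j)) -
        X * ((∑ i ∈ range (q - a), X ^ (p * i)) * ∑ j ∈ range (p - b), X ^ (q * j)) := by
  have : Fact p.Prime := ⟨hp⟩
  have hne : ∀ n : ℕ, 0 < n → (X ^ n - 1 : ℤ[X]) ≠ 0 := fun n hn => X_pow_sub_C_ne_zero hn 1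
  have hexp := cyclotomic_mul_prime_mul_X_pow_sub_one hp.pos hq
    (fun h => hpq ((Nat.prime_dvd_prime_iff_eq hq hp).1 h).symm)
  have hΦp : expand ℤ q (cyclotomic p ℤ) * (X ^ q - 1) = X ^ (p * q) - 1 := by
    have := congrArg (expand ℤ q) (cyclotomic_prime_mul_X_sub_one ℤ p)
    rwa [map_mul, map_sub, map_sub, map_pow, expand_X, map_one, ← pow_mul, mul_comm q p] at this
  have hinv : invCyclotomic p = X - 1 := by
    rw [invCyclotomic, hp.properDivisors, Finset.prod_singleton, cyclotomic_one]
  have hgeom : ∀ n c : ℕ, (∑ i ∈ range c, (X : ℤ[X]) ^ (n * i)) * (X ^ n - 1) = X ^ (n * c) - 1 := by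
    intro n c
    simp_rw [pow_mul]
    exact geom_sum_mul _ _
  have e1 := hgeom p a
  have e2 := hgeom q b
  have e3 := hgeom p (q - a)
  have e4 := hgeom q (p - b)
  have f1 : (X : ℤ[X]) ^ (p * a) * X ^ (q * b) = X ^ (p * q) * X := by
    rw [← pow_add, hab, pow_succ]
  have f2 : (X : ℤ[X]) ^ (p * (q - a)) * X ^ (p * a) = X ^ (p * q) := by
    rw [← pow_add, ← mul_add, Nat.sub_add_cancel ha]
  have f3 : (X : ℤ[X]) ^ (q * (p - b)) * X ^ (q * b) = X ^ (p * q) := by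
    rw [← pow_add, ← mul_add, Nat.sub_add_cancel hb, mul_comm]
  have f4 : (X : ℤ[X]) ^ (p * (q - a)) * X = X ^ (q * b) := by
    rw [← pow_succ]; congr 1; zify [ha] at hab ⊢; linarith
  have f5 : (X : ℤ[X]) ^ (q * (p - b)) * X = X ^ (p * a) := by
    rw [← pow_succ]; congr 1; zify [hb] at hab ⊢; linarith
  -- After multiplication by (X^p - 1)(X^q - 1) the geometric sums collapse. The rest is bookkeeping
  -- with p(q - a) + 1 = qb and q(p - b) + 1 = pa.
  apply mul_right_cancel₀ (mul_ne_zero (hne p hp.pos) (hne q hq.pos))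
  have hl : cyclotomic (p * q) ℤ * ((X ^ p - 1) * (X ^ q - 1)) = (X - 1) * (X ^ (p * q) - 1) := by
    rw [hinv] at hexp
    linear_combination (X ^ q - 1) * hexp + (X - 1) * hΦp
  have hr : ((∑ i ∈ range a, (X : ℤ[X]) ^ (p * i)) * (∑ j ∈ range b, X ^ (q * j)) -
        X * ((∑ i ∈ range (q - a), X ^ (p * i)) * ∑ j ∈ range (p - b), X ^ (q * j))) *
        ((X ^ p - 1) * (X ^ q - 1)) =
      (X ^ (p * a) - 1) * (X ^ (q * b) - 1) -
        X * ((X ^ (p * (q - a)) - 1) * (X ^ (q * (p - b)) - 1)) := by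
    rw [← e1, ← e2, ← e3, ← e4]; ring
  rw [hl, hr]
  linear_combination (-1 : ℤ[X]) * f1 + X ^ (p * (q - a)) * f5 + f2 - f4 - f5

/-- Put a' = q - a, b' = p - b and x = a'b'. The relation pa + qb = pq + 1 becomes ab = x + 1, so
the length is at most 2x + 1 while pq = 2x + 1 + s with s = ab' + a'b. By AM-GM s² ≥ 4x(x + 1),
which makes s nearly as large as 2x + 1. -/
lemma coeffSum_cyclotomic_mul_primes_le {p q : ℕ} (hp : p.Prime) (hq : q.Prime) (hpq : p ≠ q) :
    5 * coeffSum (cyclotomic (p * q) ℤ) ≤ 3 * (p * q) := by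
  obtain ⟨a, b, ha, hb, hab⟩ := exists_mul_add_mul_eq hp.one_lt hq.one_lt
    ((Nat.coprime_primes hp hq).2 hpq)
  have hgeom : ∀ n c : ℕ, coeffSum (∑ i ∈ range c, X ^ (n * i)) ≤ c := fun n c =>
    coeffSum_sum_X_pow_le (fun i => n * i) c
  have hX : coeffSum (X : ℤ[X]) = 1 := by
    simpa using coeffSum_X_pow 1
  have hS : coeffSum (cyclotomic (p * q) ℤ) ≤ a * b + (q - a) * (p - b) := by
    rw [cyclotomic_mul_eq_geom_sums hp hq hpq ha hb hab]
    refine (coeffSum_sub_le _ _).trans (Nat.add_le_add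
      ((coeffSum_mul_le _ _).trans (Nat.mul_le_mul (hgeom _ _) (hgeom _ _))) ?_)
    refine (coeffSum_mul_le _ _).trans ?_
    rw [hX, one_mul]
    exact (coeffSum_mul_le _ _).trans (Nat.mul_le_mul (hgeom _ _) (hgeom _ _))
  obtain ⟨a', rfl⟩ := Nat.exists_eq_add_of_le ha
  obtain ⟨b', rfl⟩ := Nat.exists_eq_add_of_le hb
  rw [Nat.add_sub_cancel_left, Nat.add_sub_cancel_left] at hS
  have h4 : 2 * 2 ≤ (b + b') * (a + a') := Nat.mul_le_mul hp.two_le hq.two_le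
  obtain ⟨s, hs⟩ : ∃ s, s = a * b' + a' * b := ⟨_, rfl⟩
  obtain ⟨x, hx⟩ : ∃ x, x = a' * b' := ⟨_, rfl⟩
  have hab' : a * b = x + 1 := by rw [hx]; nlinarith
  have hpq' : (b + b') * (a + a') = 2 * x + 1 + s := by rw [hs]; nlinarith
  have hsq : 4 * (x * (x + 1)) ≤ s * s := by
    have e : x * (x + 1) = (a * b') * (a' * b) := by rw [← hab', hx]; ring
    rw [e, hs]
    zify
    nlinarith [sq_nonneg ((a * b' : ℤ) - a' * b)]
  generalize coeffSum (cyclotomic _ ℤ) = L at hS ⊢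
  rw [hpq'] at h4 ⊢
  -- This is the claim 5(2x + 1) ≤ 3pq rewritten. For x = 0 the AM-GM bound is void and pq ≥ 4 gives
  -- s ≥ 3.
  have hys : 2 * (2 * x + 1) ≤ 3 * s := by
    rcases Nat.eq_zero_or_pos x with h0 | h0
    · omega
    · by_contra! hlt
      have := Nat.mul_self_lt_mul_self hlt
      nlinarith
  rw [hab', ← hx] at hS
  omega

end CyclotomicRecursion

/-! ### Normalisation by monomials in the primes, and recursions for the constants. -/

section PrimeTuples

open Polynomial Finset

/-- The product `∏ p_i ^ 2 ^ (k - 1 - i)` over `1 ≤ i ≤ k - 1`. -/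
def bigN (k : ℕ) (p : ℕ → ℕ) : ℕ := ∏ i ∈ Icc 1 (k - 1), p i ^ 2 ^ (k - 1 - i)

lemma bigM_eq_prod_Icc (k : ℕ) (p : ℕ → ℕ) :
    bigM (k + 1) p = ∏ i ∈ Icc 1 k, p i ^ (2 ^ (k - i) - 1) := by
  rcases k with _ | k
  · simp [bigM]
  · rw [Finset.prod_Icc_succ_top (by omega), bigM]
    simp only [Nat.sub_self, pow_zero, mul_one]
    refine Finset.prod_congr (by congr 1) fun i hi => ?_
    congr 3
    omega

/-- This identity and `bigN_succ` make the monomials cancel exactly in the three recursions, leaving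
only the constants c, s, t. -/
lemma bigM_succ (k : ℕ) (p : ℕ → ℕ) : bigM (k + 2) p = bigM (k + 1) p * bigN (k + 1) p := by
  rw [bigM_eq_prod_Icc, bigM_eq_prod_Icc, bigN, Finset.prod_Icc_succ_top (by omega),
    Nat.add_sub_cancel, ← Finset.prod_mul_distrib]
  simp only [Nat.sub_self, pow_zero, mul_one]
  refine Finset.prod_congr rfl fun i hi => ?_
  rw [mem_Icc] at hi
  rw [← pow_add]
  congr 1
  rw [Nat.sub_add_comm hi.2, pow_succ]
  have := Nat.one_le_two_pow (n := k - i)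
  omega

lemma bigN_succ (k : ℕ) (p : ℕ → ℕ) :
    bigN (k + 2) p = (∏ i ∈ Icc 1 (k + 1), p i) * bigM (k + 1) p * bigN (k + 1) p := by
  rw [bigM_eq_prod_Icc, bigN, bigN, Nat.add_sub_cancel, show k + 2 - 1 = k + 1 from rfl,
    Finset.prod_Icc_succ_top (by omega), Finset.prod_Icc_succ_top (by omega)]
  simp only [Nat.sub_self, pow_zero, pow_one]
  rw [mul_right_comm _ (p (k + 1)), mul_right_comm _ (p (k + 1)), ← Finset.prod_mul_distrib,
    ← Finset.prod_mul_distrib]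
  congr 1
  refine Finset.prod_congr rfl fun i hi => ?_
  rw [mem_Icc] at hi
  rw [← pow_succ', ← pow_add]
  congr 1
  rw [Nat.sub_add_comm hi.2, pow_succ]
  have := Nat.one_le_two_pow (n := k - i)
  omega

lemma DistinctPrimes.of_succ {k : ℕ} {p : ℕ → ℕ} (h : DistinctPrimes (k + 1) p) :
    DistinctPrimes k p :=
  ⟨fun i hi => h.1 i (Finset.Icc_subset_Icc_right (Nat.le_succ k) hi),
    h.2.mono (Set.Icc_subset_Icc_right (Nat.le_succ k))⟩

lemma DistinctPrimes.prime_succ {k : ℕ} {p : ℕ → ℕ} (h : DistinctPrimes (k + 1) p) :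
    (p (k + 1)).Prime :=
  h.1 _ (mem_Icc.2 ⟨by omega, le_rfl⟩)

lemma DistinctPrimes.not_dvd_prod {k : ℕ} {p : ℕ → ℕ} (h : DistinctPrimes (k + 1) p) :
    ¬p (k + 1) ∣ ∏ i ∈ Icc 1 k, p i := by
  rw [h.prime_succ.prime.dvd_finsetProd_iff]
  rintro ⟨i, hi, hd⟩
  have e := (Nat.prime_dvd_prime_iff_eq h.prime_succ (h.of_succ.1 i hi)).1 hd
  rw [mem_Icc] at hi
  have := h.2 (Set.mem_Icc.2 ⟨by omega, le_rfl⟩) (Set.mem_Icc.2 ⟨hi.1, by omega⟩) e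
  omega

lemma DistinctPrimes.one_lt_prod {k : ℕ} {p : ℕ → ℕ} (h : DistinctPrimes (k + 1) p) :
    1 < ∏ i ∈ Icc 1 (k + 1), p i := by
  rw [Finset.prod_Icc_succ_top (by omega)]
  exact one_lt_mul_of_le_of_lt
    (Nat.one_le_iff_ne_zero.2 (Finset.prod_ne_zero_iff.2 fun i hi => (h.of_succ.1 i hi).ne_zero))
    h.prime_succ.one_lt

lemma DistinctPrimes.bigM_pos {k : ℕ} {p : ℕ → ℕ} (h : DistinctPrimes k p) : 0 < bigM k p :=
  Finset.prod_pos fun i hi =>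
    pow_pos (h.1 i (Finset.Icc_subset_Icc_right (Nat.sub_le _ _) hi)).pos _

lemma exists_distinctPrimes (k : ℕ) : ∃ p, DistinctPrimes k p :=
  ⟨Nat.nth Nat.Prime, fun i _ => Nat.prime_nth_prime i,
    (Nat.nth_injective Nat.infinite_setOfPred_prime).injOn⟩

/-- `s` bounds the lengths of the cyclotomic polynomials of order `p_1 ⋯ p_k`, relative to
`p_1 ⋯ p_k M_k`. -/
def LengthBound (k : ℕ) (s : ℝ) : Prop :=
  ∀ p, DistinctPrimes k p → (coeffSum (cyclotomic (∏ i ∈ Icc 1 k, p i) ℤ) : ℝ) ≤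
    s * (((∏ i ∈ Icc 1 k, p i : ℕ) : ℝ) * bigM k p)

/-- `t` bounds the lengths of the inverse cyclotomic polynomials of order `p_1 ⋯ p_k`, relative
to `bigN k p`. -/
def InvLengthBound (k : ℕ) (t : ℝ) : Prop :=
  ∀ p, DistinctPrimes k p →
    (coeffSum (invCyclotomic (∏ i ∈ Icc 1 k, p i)) : ℝ) ≤ t * bigN k p

lemma LengthBound.succ {k : ℕ} {s t : ℝ} (hs : 0 ≤ s) (h : LengthBound (k + 1) s)
    (h' : InvLengthBound (k + 1) t) : LengthBound (k + 2) (s * t / 2) := by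
  intro p hp
  have h1 := two_mul_coeffSum_cyclotomic_mul_prime_le hp.of_succ.one_lt_prod hp.prime_succ
    hp.not_dvd_prod
  rw [← Finset.prod_Icc_succ_top (by omega)] at h1
  have h2 := mul_le_mul (h p hp.of_succ) (h' p hp.of_succ) (by positivity) (by positivity)
  have h3 := mul_le_mul_of_nonneg_left h2 (Nat.cast_nonneg (α := ℝ) (p (k + 2)))
  rw [bigM_succ]
  have h4 : (2 * coeffSum (cyclotomic (∏ i ∈ Icc 1 (k + 2), p i) ℤ) : ℝ) ≤ _ :=
    (by exact_mod_cast h1 : _ ≤ (p (k + 2) : ℝ) * (_ * _)).trans h3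
  rw [Finset.prod_Icc_succ_top (b := k + 1) (by omega)] at h4 ⊢
  push_cast at h4 ⊢
  linarith

lemma InvLengthBound.succ {k : ℕ} {s t : ℝ} (hs : 0 ≤ s) (h : LengthBound (k + 1) s)
    (h' : InvLengthBound (k + 1) t) : InvLengthBound (k + 2) (s * t) := by
  intro p hp
  have h1 := coeffSum_invCyclotomic_mul_prime_le (by have := hp.of_succ.one_lt_prod; omega)
    hp.prime_succ hp.not_dvd_prod
  rw [← Finset.prod_Icc_succ_top (by omega)] at h1
  have h2 := mul_le_mul (h p hp.of_succ) (h' p hp.of_succ) (by positivity) (by positivity)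
  rw [bigN_succ]
  refine (by exact_mod_cast h1 : _ ≤ (_ * _ : ℝ)).trans (h2.trans_eq ?_)
  push_cast
  ring

lemma mul_mem_heightConstants_succ {k : ℕ} {c t : ℝ} (ht : 0 < t)
    (hc : c ∈ heightConstants (k + 1)) (h' : InvLengthBound (k + 1) t) :
    c * t ∈ heightConstants (k + 2) := by
  refine ⟨mul_pos hc.1 ht, fun p hp => ?_⟩
  have h1 := cycHeight_mul_prime_le hp.of_succ.one_lt_prod hp.prime_succ hp.not_dvd_prod
  rw [← Finset.prod_Icc_succ_top (by omega)] at h1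
  have h2 := mul_le_mul (hc.2 p hp.of_succ) (h' p hp.of_succ) (by positivity)
    (mul_nonneg hc.1.le (Nat.cast_nonneg _))
  rw [bigM_succ]
  refine (by exact_mod_cast h1 : _ ≤ (_ * _ : ℝ)).trans (h2.trans_eq ?_)
  push_cast
  ring

/-! ### Initial values of the constants. -/

lemma lengthBound_one : LengthBound 1 1 := by
  intro p hp
  have h := coeffSum_cyclotomic_prime_le hp.prime_succ
  simpa [bigM] using h

lemma invLengthBound_one : InvLengthBound 1 2 := by
  intro p hp
  have h := coeffSum_invCyclotomic_prime_le hp.prime_succ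
  simpa [bigN] using h

lemma one_mem_heightConstants_one : 1 ∈ heightConstants 1 := by
  refine ⟨one_pos, fun p hp => ?_⟩
  have h := cycHeight_prime_le hp.prime_succ
  simpa [bigM] using h

lemma lengthBound_two : LengthBound 2 (3 / 5) := by
  intro p hp
  have hne : p 1 ≠ p 2 := fun e => by
    have := hp.2 (Set.mem_Icc.2 ⟨by omega, by omega⟩) (Set.mem_Icc.2 ⟨by omega, by omega⟩) e
    omega
  have h := coeffSum_cyclotomic_mul_primes_le hp.of_succ.prime_succ hp.prime_succ hne
  have e : ∏ i ∈ Icc 1 2, p i = p 1 * p 2 := by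
    rw [Finset.prod_Icc_succ_top (by omega)]; simp
  have h' : (5 * coeffSum (cyclotomic (p 1 * p 2) ℤ) : ℝ) ≤ 3 * (p 1 * p 2) := by
    exact_mod_cast h
  rw [e]
  simp only [bigM, Nat.cast_mul]
  simp
  linarith

lemma invLengthBound_two : InvLengthBound 2 2 := by
  simpa using InvLengthBound.succ zero_le_one lengthBound_one invLengthBound_one

/-- Values play no role here: this gives the existence of every ε_k and a starting height constant
for four primes. -/
lemma exists_mem_heightConstants_and_bounds (k : ℕ) :
    ∃ c s t : ℝ, c ∈ heightConstants (k + 1) ∧ 0 < s ∧ 0 < t ∧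
      LengthBound (k + 1) s ∧ InvLengthBound (k + 1) t := by
  induction k with
  | zero => exact ⟨1, 1, 2, one_mem_heightConstants_one, one_pos, two_pos, lengthBound_one,
      invLengthBound_one⟩
  | succ k ih =>
    obtain ⟨c, s, t, hc, hs, ht, h, h'⟩ := ih
    exact ⟨c * t, s * t / 2, s * t, mul_mem_heightConstants_succ ht hc h', by positivity,
      by positivity, h.succ hs.le h', h'.succ hs.le h⟩

end PrimeTuples

/-! ### The constants ε_k, d, ρ, C and the final comparison. -/

section Constants

lemma div_bigM_le {k : ℕ} {p : ℕ → ℕ} (hp : DistinctPrimes k p) {c : ℝ}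
    (hc : c ∈ heightConstants k) :
    (cycHeight (∏ i ∈ Finset.Icc 1 k, p i) : ℝ) / bigM k p ≤ c :=
  (div_le_iff₀ (by exact_mod_cast hp.bigM_pos)).2 (hc.2 p hp)

lemma isLeast_eps {k : ℕ} (hk : 1 ≤ k) : IsLeast (heightConstants k) (eps k) := by
  obtain ⟨k, rfl⟩ := Nat.exists_eq_add_of_le' hk
  obtain ⟨c, -, -, hc, -⟩ := exists_mem_heightConstants_and_bounds k
  have hne : (heightConstants (k + 1)).Nonempty := ⟨c, hc⟩
  -- Each ratio is a lower bound for the admissible constants, hence for their infimum. So the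
  -- infimum is itself admissible, and it is positive because heights are at least 1.
  have hle : ∀ p, DistinctPrimes (k + 1) p →
      (cycHeight (∏ i ∈ Finset.Icc 1 (k + 1), p i) : ℝ) / bigM (k + 1) p ≤ eps (k + 1) :=
    fun p hp => le_csInf hne fun c hc => div_bigM_le hp hc
  refine ⟨⟨?_, fun p hp => ?_⟩, fun c hc => csInf_le ⟨0, fun x hx => hx.1.le⟩ hc⟩
  · obtain ⟨p, hp⟩ := exists_distinctPrimes (k + 1)
    refine lt_of_lt_of_le (div_pos ?_ ?_) (hle p hp)
    · exact_mod_cast one_le_cycHeight _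
    · exact_mod_cast hp.bigM_pos
  · exact (div_le_iff₀ (by exact_mod_cast hp.bigM_pos)).1 (hle p hp)

lemma distinctPrimes_triple {p q r : ℕ} (hp : p.Prime) (hq : q.Prime) (hr : r.Prime)
    (hpq : p ≠ q) (hpr : p ≠ r) (hqr : q ≠ r) :
    DistinctPrimes 3 fun i => if i = 1 then p else if i = 2 then q else r := by
  refine ⟨fun i _ => by dsimp only; split_ifs <;> assumption, ?_⟩
  intro i hi j hj h
  rw [Set.mem_Icc] at hi hj
  obtain ⟨hi1, hi3⟩ := hi
  obtain ⟨hj1, hj3⟩ := hj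
  interval_cases i <;> interval_cases j <;> simp_all [eq_comm]

lemma prod_Icc_three (p : ℕ → ℕ) : ∏ i ∈ Finset.Icc 1 3, p i = p 1 * p 2 * p 3 := by
  rw [Finset.prod_Icc_succ_top (by omega), Finset.prod_Icc_succ_top (by omega)]
  simp

lemma bigM_three (p : ℕ → ℕ) : bigM 3 p = p 1 := by
  simp [bigM]

/-- The triple (2, 3, 5) has M_3 = 2 and height at least 1. -/
lemma half_le_eps_three : 1 / 2 ≤ eps 3 := by
  have hp := distinctPrimes_triple Nat.prime_two Nat.prime_three Nat.prime_five
    (by norm_num) (by norm_num) (by norm_num)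
  refine le_trans ?_ (div_bigM_le hp (isLeast_eps (by norm_num : 1 ≤ 3)).1)
  rw [bigM_three]
  simp only [if_true, Nat.cast_ofNat]
  gcongr
  exact_mod_cast one_le_cycHeight _

lemma lengthBound_three : LengthBound 3 (3 / 5) := by
  have h := LengthBound.succ (by norm_num) lengthBound_two invLengthBound_two
  norm_num at h
  exact h

lemma lengthRatios_le {x : ℝ} (hx : x ∈ lengthRatios) : x ≤ 3 / 5 := by
  obtain ⟨p, q, r, hp, hq, hr, hpq, hpr, hqr, rfl⟩ := hx
  have h := lengthBound_three _ (distinctPrimes_triple hp hq hr hpq hpr hqr)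
  rw [prod_Icc_three, bigM_three, ← cycLength_eq_coeffSum] at h
  simp only [if_true, OfNat.ofNat_ne_one, if_false, Nat.reduceEqDiff, Nat.cast_mul] at h
  have := hp.pos
  have := hq.pos
  have := hr.pos
  rw [div_le_iff₀ (by positivity)]
  linarith

lemma mem_lengthRatios {p : ℕ → ℕ} (hp : DistinctPrimes 3 p) :
    (cycLength (p 1 * p 2 * p 3) : ℝ) / ((p 1 : ℝ) ^ 2 * p 2 * p 3) ∈ lengthRatios := by
  have hne : ∀ i j, 1 ≤ i → i < j → j ≤ 3 → p i ≠ p j := fun i j h1 h2 h3 e => by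
    have := hp.2 (Set.mem_Icc.2 ⟨h1, by omega⟩) (Set.mem_Icc.2 ⟨by omega, h3⟩) e
    omega
  exact ⟨p 1, p 2, p 3, hp.of_succ.of_succ.prime_succ, hp.of_succ.prime_succ, hp.prime_succ,
    hne 1 2 (by omega) (by omega) (by omega), hne 1 3 (by omega) (by omega) (by omega),
    hne 2 3 (by omega) (by omega) (by omega), rfl⟩

lemma isLUB_dConst : IsLUB lengthRatios dConst := by
  obtain ⟨p, hp⟩ := exists_distinctPrimes 3
  exact isLUB_csSup ⟨_, mem_lengthRatios hp⟩ ⟨3 / 5, fun x hx => lengthRatios_le hx⟩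

lemma dConst_le : dConst ≤ 3 / 5 := isLUB_dConst.2 fun _ hx => lengthRatios_le hx

lemma lengthBound_three_dConst : LengthBound 3 dConst := by
  intro p hp
  have h := isLUB_dConst.1 (mem_lengthRatios hp)
  have := hp.of_succ.of_succ.prime_succ.pos
  have := hp.of_succ.prime_succ.pos
  have := hp.prime_succ.pos
  rw [div_le_iff₀ (by positivity), cycLength_eq_coeffSum] at h
  rw [prod_Icc_three, bigM_three]
  push_cast
  linarith

lemma dConst_pos : 0 < dConst := by
  obtain ⟨p, hp⟩ := exists_distinctPrimes 3
  refine lt_of_lt_of_le ?_ (isLUB_dConst.1 (mem_lengthRatios hp))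
  have := hp.of_succ.of_succ.prime_succ.pos
  have := hp.of_succ.prime_succ.pos
  have := hp.prime_succ.pos
  have h : 0 < cycLength (p 1 * p 2 * p 3) := by
    rw [cycLength_eq_coeffSum]
    exact coeffSum_pos (Polynomial.cyclotomic.monic _ ℤ)
  positivity

/-- At three primes s = d and t = 6/5, so at four primes s = 3d/5 and t = 2s. The relation t = 2s
persists and turns s ↦ st/2 into squaring. -/
lemma length_bounds_pow (k : ℕ) :
    LengthBound (k + 4) ((3 / 5 * dConst) ^ 2 ^ k) ∧
      InvLengthBound (k + 4) (2 * (3 / 5 * dConst) ^ 2 ^ k) := by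
  have hd := dConst_pos
  induction k with
  | zero =>
    have h3 : InvLengthBound 3 (3 / 5 * 2) :=
      InvLengthBound.succ (by norm_num) lengthBound_two invLengthBound_two
    have h := LengthBound.succ hd.le lengthBound_three_dConst h3
    have h' := InvLengthBound.succ hd.le lengthBound_three_dConst h3
    constructor
    · convert h using 1
      ring
    · convert h' using 1
      ring
  | succ k ih =>
    have h := LengthBound.succ (by positivity) ih.1 ih.2
    have h' := InvLengthBound.succ (by positivity) ih.1 ih.2
    constructor
    · convert h using 1
      rw [pow_succ 2 k, pow_mul]
      ring
    · convert h' using 1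
      rw [pow_succ 2 k, pow_mul]
      ring

lemma exists_mem_heightConstants_pow :
    ∃ E : ℝ, 0 < E ∧ ∀ k : ℕ,
      E * 2 ^ k * (3 / 5 * dConst) ^ 2 ^ k ∈ heightConstants (k + 4) := by
  have hd := dConst_pos
  obtain ⟨c, -, -, hc, -⟩ := exists_mem_heightConstants_and_bounds 3
  have hc0 := hc.1
  -- Dividing by 3d/5 makes k = 0 return c. Each step then multiplies by 2(3d/5)^(2^k), which
  -- doubles the exponent 2^k and adds one factor 2.
  refine ⟨c / (3 / 5 * dConst), by positivity, fun k => ?_⟩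
  induction k with
  | zero =>
    convert hc using 1
    rw [pow_zero, pow_zero, pow_one, mul_one, div_mul_cancel₀ _ (by positivity)]
  | succ k ih =>
    convert mul_mem_heightConstants_succ (by positivity) ih (length_bounds_pow k).2 using 1
    rw [pow_succ 2 k, show 2 ^ (k + 1) = 2 ^ k * 2 from pow_succ 2 k, pow_mul]
    ring

lemma rhoFactor_pos (i : ℕ) : 0 < rhoFactor i := by
  unfold rhoFactor; positivity

lemma neg_log_rhoFactor_mem (i : ℕ) :
    0 ≤ -Real.log (rhoFactor i) ∧ -Real.log (rhoFactor i) ≤ Real.log (6 / 5) * (1 / 2) ^ i := by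
  have h5 : (0 : ℝ) < 2 * i + 5 := by positivity
  have h6 : (0 : ℝ) < 2 * i + 6 := by positivity
  rw [rhoFactor, Real.log_rpow (by positivity), ← mul_neg, ← Real.log_inv, inv_div, one_div_pow,
    mul_comm (Real.log _)]
  have h1 : (1 : ℝ) ≤ (2 * i + 6) / (2 * i + 5) := by rw [le_div_iff₀ h5]; linarith
  have h2 : (2 * i + 6) / (2 * i + 5) ≤ (6 / 5 : ℝ) := by
    rw [div_le_iff₀ h5]; linarith [Nat.cast_nonneg (α := ℝ) i]
  have h3 := Real.log_nonneg h1
  exact ⟨by positivity, by gcongr⟩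

lemma summable_log_rhoFactor : Summable fun i => Real.log (rhoFactor i) := by
  rw [← summable_neg_iff]
  exact Summable.of_nonneg_of_le (fun i => (neg_log_rhoFactor_mem i).1)
    (fun i => (neg_log_rhoFactor_mem i).2) (summable_geometric_two.mul_left _)

/-- Each factor is at least (5/6)^(1/2^i), and these exponents sum to 2. -/
lemma le_rhoConst : 25 / 36 ≤ rhoConst := by
  rw [rhoConst, ← Real.rexp_tsum_eq_tprod rhoFactor_pos summable_log_rhoFactor]
  have h : -∑' i, Real.log (rhoFactor i) ≤ Real.log (6 / 5) * 2 := by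
    rw [← tsum_neg, ← tsum_geometric_two, ← tsum_mul_left]
    exact summable_log_rhoFactor.neg.tsum_le_tsum (fun i => (neg_log_rhoFactor_mem i).2)
      (summable_geometric_two.mul_left _)
  have h2 : Real.log (25 / 36) = -(Real.log (6 / 5) * 2) := by
    rw [mul_comm, ← Nat.cast_ofNat (R := ℝ) (n := 2), ← Real.log_pow, ← Real.log_inv]
    norm_num
  rw [← Real.log_le_iff_le_exp (by norm_num), h2]
  linarith

lemma rpow_le_bigC : (3 / 5 * dConst) ^ (1 / 16 : ℝ) ≤ bigC := by
  have hd := dConst_pos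
  have hd' := dConst_le
  have hε := half_le_eps_three
  have h1 : (1 / 2 * (7 / 10) : ℝ) ≤ eps 3 ^ (3 / 2 : ℝ) := by
    rw [show (3 / 2 : ℝ) = 1 + 1 / 2 by norm_num, Real.rpow_add (by linarith), Real.rpow_one,
      ← Real.sqrt_eq_rpow]
    have : (7 / 10 : ℝ) ≤ √(eps 3) := Real.le_sqrt_of_sq_le (by linarith)
    gcongr
  have h2 : (9 / 10 : ℝ) ≤ rhoConst ^ (1 / 4 : ℝ) := by
    have h := Real.rpow_le_rpow (z := 1 / 4) (by norm_num)
      ((by norm_num : (9 / 10 : ℝ) ^ 4 ≤ 25 / 36).trans le_rhoConst) (by norm_num)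
    rwa [← Real.rpow_natCast, ← Real.rpow_mul (by norm_num), Nat.cast_ofNat,
      mul_one_div_cancel (by norm_num), Real.rpow_one] at h
  have h3 : (3 / 5 * dConst) ^ 2 ≤
      3 / 4 * eps 3 ^ (3 / 2 : ℝ) * dConst * rhoConst ^ (1 / 4 : ℝ) := by
    -- Since d ≤ 3/5, the left side is at most 0.216 d, against 0.23625 d on the right.
    calc (3 / 5 * dConst) ^ 2 ≤ 3 / 4 * (1 / 2 * (7 / 10)) * dConst * (9 / 10) := by nlinarith
      _ ≤ _ := by gcongr
  have h4 := Real.rpow_le_rpow (z := 1 / 32) (by positivity) h3 (by norm_num)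
  rw [← Real.rpow_natCast, ← Real.rpow_mul (by positivity)] at h4
  norm_num at h4 ⊢
  rw [bigC]
  norm_num
  exact h4

/-- The factor E 2^k has logarithm linear in k, which is negligible against 2^(k+4). Only
(3d/5)^(2^k) survives, with weight 1/16. -/
lemma tendsto_exponent (e y : ℝ) :
    Tendsto (fun k : ℕ => (e + k * Real.log 2 + 2 ^ k * y) / 2 ^ (k + 4)) atTop
      (𝓝 (y * (1 / 16))) := by
  have h1 : Tendsto (fun k : ℕ => (1 / 2 : ℝ) ^ k) atTop (𝓝 0) :=
    tendsto_pow_atTop_nhds_zero_of_lt_one (by norm_num) (by norm_num)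
  have h2 : Tendsto (fun k : ℕ => (k : ℝ) * (1 / 2 : ℝ) ^ k) atTop (𝓝 0) :=
    tendsto_self_mul_const_pow_of_lt_one (by norm_num) (by norm_num)
  have h3 := ((h1.mul_const (e / 16)).add (h2.mul_const (Real.log 2 / 16))).add_const
    (y * (1 / 16))
  simp only [zero_mul, zero_add] at h3
  refine h3.congr fun k => ?_
  rw [pow_add, one_div_pow]
  field_simp
  ring

/-- This sequence serves as δ: it is the excess of ε_k^(1/2^k) over C, cut off at 0, so it vanishes
in the limit even if C is not sharp. -/
lemma tendsto_max_exp_log_eps :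
    Tendsto (fun k : ℕ => max 0 (Real.exp (Real.log (eps k) / 2 ^ k) - bigC)) atTop (𝓝 0) := by
  have hd := dConst_pos
  obtain ⟨E, hE, hmem⟩ := exists_mem_heightConstants_pow
  rw [← tendsto_add_atTop_iff_nat 4]
  have hlim := (((Real.continuous_exp.tendsto _).comp
    (tendsto_exponent (Real.log E) (Real.log (3 / 5 * dConst)))).sub_const bigC)
  have hlim' := (tendsto_const_nhds (x := (0 : ℝ))).max hlim
  rw [← Real.rpow_def_of_pos (by positivity), max_eq_left (sub_nonpos.2 rpow_le_bigC)] at hlim'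
  refine squeeze_zero (fun k => le_max_left _ _) (fun k => ?_) hlim'
  have hle := Real.log_le_log (isLeast_eps (by omega : 1 ≤ k + 4)).1.1
    ((isLeast_eps (by omega : 1 ≤ k + 4)).2 (hmem k))
  rw [Real.log_mul (by positivity) (by positivity), Real.log_mul (by positivity) (by positivity),
    Real.log_pow, Real.log_pow] at hle
  push_cast at hle
  simp only [Function.comp_apply]
  gcongr

end Constants

theorem theorem1 :
    (∀ k : ℕ, 1 ≤ k → IsLeast (heightConstants k) (eps k)) ∧
    IsLUB lengthRatios dConst ∧
    Multipliable rhoFactor ∧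
    ∃ δ : ℕ → ℝ, Tendsto δ atTop (𝓝 0) ∧
      ∀ k : ℕ, 1 ≤ k →
        0 < bigC + δ k ∧ Real.log (eps k) ≤ 2 ^ k * Real.log (bigC + δ k) := by
  refine ⟨fun k hk => isLeast_eps hk, isLUB_dConst,
    Real.multipliable_of_summable_log rhoFactor_pos summable_log_rhoFactor,
    _, tendsto_max_exp_log_eps, fun k _ => ?_⟩
  have h : Real.exp (Real.log (eps k) / 2 ^ k) ≤
      bigC + max 0 (Real.exp (Real.log (eps k) / 2 ^ k) - bigC) := by
    linarith [le_max_right 0 (Real.exp (Real.log (eps k) / 2 ^ k) - bigC)]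
  have hpos := (Real.exp_pos _).trans_le h
  refine ⟨hpos, ?_⟩
  have h2 := (Real.le_log_iff_exp_le hpos).2 h
  rwa [div_le_iff₀' (by positivity)] at h2
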